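/- Let $\mu,\varepsilon,\nu,\omega,c_0\in\mathbb C$, let $\lambda\in\{0,\,1-\nu\}$ be an indicial exponent at $x=0$ of the grand confluent hypergeometric (GCH) equation $$x y''+(\mu x^2+\varepsilon x+\nu)y'+(\Omega x+\varepsilon\omega)y=0 ,$$ and assume $\operatorname{Re}\lambda>-1$ and $\operatorname{Re}(\nu+\lambda)>0$ (so that the integrals below converge). Substituting $y=\sum_m c_mx^{m+\lambda}$ gives $c_{m+1}=A_mc_m+B_mc_{m-1}$ $(c_{-1}=0)$ with $$A_m=-\frac{\varepsilon(m+\omega+\lambda)}{(m+1+\lambda)(m+\nu+\lambda)},\qquad B_m=-\frac{\Omega+\mu(m-1+\lambda)}{(m+1+\lambda)(m+\nu+\lambda)} .$$ Let $\beta_0\le\beta_1\le\beta_2\le\cdots$ be non-negative integers and $\Omega_i=-\mu(2\beta_i+i+\lambda)$. Let $c_{m,n}$ be the part of $c_m$ consisting of the products with exactly $n$ factors $A$, where every factor $B$ standing after exactly $n$ factors $A$ is formed with $\Omega=\Omega_n$; that is, $c_{0,0}=c_0$, $c_{0,n}=0$ for $n\ge1$, and $$c_{m+1,n}=A_mc_{m,n-1}+B_m|_{\Omega=\Omega_n}\,c_{m-1,n}\qquad(c_{m,-1}=c_{-1,n}=0).$$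 Put $y_n(x)=x^\lambda\sum_m c_{m,n}x^m$, and let the GCH polynomial which makes the $B_n$ term terminated be $y(x)=x^\lambda\sum_m\big(\sum_{n\le m}c_{m,n}\big)x^m$. Put $\gamma=\frac12(1+\nu)$, $z=-\frac12\mu x^2$, $\tilde\varepsilon=-\frac12\varepsilon x$, let $(a)_i=a(a+1)\cdots(a+i-1)$, and $$G_0(w)=\sum_{i_0=0}^{\beta_0}\frac{(-\beta_0)_{i_0}}{(1+\frac\lambda2)_{i_0}(\gamma+\frac\lambda2)_{i_0}}\,w^{i_0},$$ and for $j\ge1$ $$G_j(w)=\int_0^1\!dt\,t^{\frac j2-1+\frac\lambda2}\int_0^1\!du\,u^{\gamma+\frac j2-2+\frac\lambda2}\,\frac1{2\pi i}\oint_{|v|=r_j}\!dv\,\frac{\exp\!\big(-\frac{v}{1-v}w(1-t)(1-u)\big)}{v^{\beta_j+1}(1-v)}\Big[\big(s\partial_s+\tfrac12(j-1+\omega+\lambda)\big)G_{j-1}(s)\Big]_{s=w\,t\,u\,v},$$ where $0<r_j<1$ are arbitrary radii. Thus $G_n(z)$ consists of the nested operators with indices $n,n-1,\dots,1$, the operator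 with index $j$ having $w=w_{j+1,n}$ and $s=w_{j,n}$ with $w_{a,b}=z\prod_{l=a}^b t_lu_lv_l$ ($w_{n+1,n}=z$), applied to $G_0(w_{1,n})$. Then for every $x\in\mathbb C$: 1. $c_{m,n}=0$ for $m>n+2\beta_n$, so every $y_n$ is $x^\lambda$ times a polynomial. 2. Every $G_j$ is entire, and all the integrals above converge absolutely. 3. For every $n\ge0$, $y_n(x)=c_0x^\lambda\,G_n(z)\,\tilde\varepsilon^{\,n}$, and also $$y_n(x)=c_0x^\lambda\,\tilde\varepsilon^{\,n}\sum_{\substack{0\le i_0\le\beta_0\\ i_{k-1}\le i_k\le\beta_k}}\frac{(-\beta_0)_{i_0}}{(1+\frac\lambda2)_{i_0}(\gamma+\frac\lambda2)_{i_0}}\prod_{k=0}^{n-1}\frac{i_k+\frac\lambda2+\frac\omega2+\frac k2}{(i_k+\frac12+\frac\lambda2+\frac k2)(i_k-\frac12+\gamma+\frac k2+\frac\lambda2)}\,R_{k+1}(i_k,i_{k+1})\;z^{i_n},$$ where $R_k(a,b)=\dfrac{(-\beta_k)_b(1+\frac k2+\frac\lambda2)_a(\frac k2+\gamma+\frac\lambda2)_a}{(-\beta_k)_a(1+\frac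 k2+\frac\lambda2)_b(\frac k2+\gamma+\frac\lambda2)_b}$. 4. If $\sum_{m,n}c_{m,n}x^m$ converges absolutely, then $y(x)=\sum_{n\ge0}y_n(x)$ and $$y(x)=c_0x^\lambda\Big\{G_0(z)+\sum_{n=1}^\infty G_n(z)\,\tilde\varepsilon^{\,n}\Big\}$$ (a convergent series whenever $c_0x^\lambda\ne0$). The absolute convergence holds for all $x$ as soon as $\beta_n=o(n^2)$. -/

import Mathlib

/-- The Pochhammer symbol (rising factorial) `(a)_n = a (a+1) ⋯ (a+n-1)`. -/
noncomputable def poch (a : ℂ) (n : ℕ) : ℂ := (ascPochhammer ℂ n).eval a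

/-! ### The Frobenius series

Substituting `y = ∑ c_m x^(m+lam)` into
`x y'' + (μ x² + ε x + ν) y' + (Ω x + ε ω) y = 0` gives, for `m ≥ 0` and `c_{-1} = 0`,
`c_{m+1} = A_m c_m + B_m c_{m-1}` with `A_m`, `B_m` as follows. -/

/-- The coefficient `A_m` of the three-term recurrence. -/
noncomputable def recA (ε ν ω lam : ℂ) (m : ℕ) : ℂ :=
  -(ε * (m + ω + lam)) / ((m + 1 + lam) * (m + ν + lam))

/-- The coefficient `B_m` of the three-term recurrence. -/
noncomputable def recB (μ ν lam Ω : ℂ) (m : ℕ) : ℂ :=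
  -(Ω + μ * (m - 1 + lam)) / ((m + 1 + lam) * (m + ν + lam))

/-- `shiftRight f 0 = 0` and `shiftRight f (n+1) = f n`. -/
def shiftRight (f : ℕ → ℂ) : ℕ → ℂ
  | 0 => 0
  | n + 1 => f n

/-- `gchCoeff … m n` is the part of the Frobenius coefficient `c_m` that contains exactly `n`
factors `A`; every factor `B` standing after exactly `n` factors `A` is formed with `Ω n`. If
`Ω` is a constant sequence, then `∑ n ≤ m, gchCoeff … m n` is the solution `c_m` of the
three-term recurrence with that constant. -/
noncomputable def gchCoeff (μ ε ν ω lam c₀ : ℂ) (Ω : ℕ → ℂ) : ℕ → ℕ → ℂ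
  | 0 => fun n => if n = 0 then c₀ else 0
  | 1 => fun n => recA ε ν ω lam 0 * shiftRight (gchCoeff μ ε ν ω lam c₀ Ω 0) n
  | m + 2 => fun n =>
      recA ε ν ω lam (m + 1) * shiftRight (gchCoeff μ ε ν ω lam c₀ Ω (m + 1)) n
        + recB μ ν lam (Ω n) (m + 1) * gchCoeff μ ε ν ω lam c₀ Ω m n

/-- The sub-power series `y_n(x)`: the terms of the Frobenius series with exactly `n`
factors `A`. -/
noncomputable def gchSub (μ ε ν ω lam c₀ : ℂ) (Ω : ℕ → ℂ) (n : ℕ) (x : ℂ) : ℂ :=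
  x ^ lam * ∑' m : ℕ, gchCoeff μ ε ν ω lam c₀ Ω m n * x ^ m

/-- The Frobenius series `y(x) = ∑ c_m x^(m+lam)`, with `c_m = ∑ n ≤ m, gchCoeff … m n`. -/
noncomputable def gchPolynomial (μ ε ν ω lam c₀ : ℂ) (Ω : ℕ → ℂ) (x : ℂ) : ℂ :=
  x ^ lam * ∑' m : ℕ, (∑ n ∈ Finset.range (m + 1), gchCoeff μ ε ν ω lam c₀ Ω m n) * x ^ m

/-! ### The power series in closed form -/

/-- The quotient
`(-β_k)_b (1+k/2+lam/2)_a (k/2+γ+lam/2)_a / ((-β_k)_a (1+k/2+lam/2)_b (k/2+γ+lam/2)_b)`. -/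
noncomputable def pochRatio (γ lam : ℂ) (β : ℕ → ℕ) (k a b : ℕ) : ℂ :=
  (poch (-(β k : ℂ)) b * poch (1 + k / 2 + lam / 2) a * poch (k / 2 + γ + lam / 2) a)
    / (poch (-(β k : ℂ)) a * poch (1 + k / 2 + lam / 2) b * poch (k / 2 + γ + lam / 2) b)

/-- The `n`-fold nested sum over `0 ≤ i₀ ≤ β₀`, `i_{k-1} ≤ i_k ≤ β_k` (`1 ≤ k ≤ n`). -/
noncomputable def gchClosedSum (γ ω lam : ℂ) (β : ℕ → ℕ) (n : ℕ) (z : ℂ) : ℂ :=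
  ∑ i ∈ (Fintype.piFinset fun k : Fin (n + 1) => Finset.range (β k + 1)) with
      (∀ k : Fin n, i k.castSucc ≤ i k.succ),
    poch (-(β 0 : ℂ)) (i 0) / (poch (1 + lam / 2) (i 0) * poch (γ + lam / 2) (i 0))
      * (∏ k : Fin n,
          ((i k.castSucc : ℂ) + lam / 2 + ω / 2 + (k : ℕ) / 2)
            / (((i k.castSucc : ℂ) + 1 / 2 + lam / 2 + (k : ℕ) / 2)
                * ((i k.castSucc : ℂ) - 1 / 2 + γ + (k : ℕ) / 2 + lam / 2))
            * pochRatio γ lam β (k + 1) (i k.castSucc) (i k.succ))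
      * z ^ i (Fin.last n)

/-! ### The integral representation -/

/-- The finite hypergeometric sum to which the operators are applied. -/
noncomputable def baseSum (γ lam : ℂ) (β : ℕ → ℕ) (w : ℂ) : ℂ :=
  ∑ i ∈ Finset.range (β 0 + 1),
    poch (-(β 0 : ℂ)) i / (poch (1 + lam / 2) i * poch (γ + lam / 2) i) * w ^ i

/-- The differential operator `s ∂_s + ½ (j - 1 + ω + lam)`. -/
noncomputable def eulerOp (ω lam : ℂ) (j : ℕ) (f : ℂ → ℂ) (s : ℂ) : ℂ :=
  s * deriv f s + 1 / 2 * ((j : ℂ) - 1 + ω + lam) * f s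

/-- The integrand of the contour integral in `v = v_j`; here `w` is `w_{j+1,n}`, and the
differential operator acts on `f` as a function of `w_{j,n} = w_{j+1,n} t_j u_j v_j`. -/
noncomputable def vIntegrand (ω lam : ℂ) (β : ℕ → ℕ) (j : ℕ) (f : ℂ → ℂ) (w : ℂ)
    (t u : ℝ) (v : ℂ) : ℂ :=
  Complex.exp (-(v / (1 - v)) * w * (1 - t) * (1 - u)) / (v ^ (β j + 1) * (1 - v))
    * eulerOp ω lam j f (w * t * u * v)

/-- The integrand of the integral in `u = u_j`; the contour is the circle `|v| = r_j`,
described once counterclockwise. -/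
noncomputable def uIntegrand (γ ω lam : ℂ) (β : ℕ → ℕ) (r : ℕ → ℝ) (j : ℕ) (f : ℂ → ℂ) (w : ℂ)
    (t u : ℝ) : ℂ :=
  (u : ℂ) ^ (γ + (j : ℂ) / 2 - 2 + lam / 2)
    * (1 / (2 * (Real.pi : ℂ) * Complex.I) * ∮ v in C(0, r j), vIntegrand ω lam β j f w t u v)

/-- The integrand of the integral in `t = t_j`. -/
noncomputable def tIntegrand (γ ω lam : ℂ) (β : ℕ → ℕ) (r : ℕ → ℝ) (j : ℕ) (f : ℂ → ℂ) (w : ℂ)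
    (t : ℝ) : ℂ :=
  (t : ℂ) ^ ((j : ℂ) / 2 - 1 + lam / 2) * ∫ u in (0 : ℝ)..1, uIntegrand γ ω lam β r j f w t u

/-- The nested operators with indices `n, n-1, …, 1`, the operator `n` being the outermost one,
applied to `baseSum`, as a function of the outermost variable `w = w_{n+1,n}`. -/
noncomputable def nestedIntegral (γ ω lam : ℂ) (β : ℕ → ℕ) (r : ℕ → ℝ) : ℕ → ℂ → ℂ
  | 0 => baseSum γ lam β
  | n + 1 => fun w =>
      ∫ t in (0 : ℝ)..1, tIntegrand γ ω lam β r (n + 1) (nestedIntegral γ ω lam β r n) w t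

/-! A factor `A` raises `m` by 1 and a factor `B` raises it by 2, so only the coefficients with `m =
n + 2i` survive. After powers of `-ε/2` and `-μ/2` are split off, they are numbers e_n(b) with
e_{n+1}(b+1) = T_n(b+1) e_n(b+1) + S_{n+1}(b) e_{n+1}(b), where T is `transferFactor` and S is
`pochStep`. Since R_{n+1}(a,·) (`pochRatio`) solves the homogeneous part, variation of constants
gives e_{n+1}(b) = ∑_{a≤b} e_n(a) T_n(a) R_{n+1}(a,b). Iterating yields the nested sum
(`gchCoeff_even`, `gchClosedSum_eq`). It terminates because S_n vanishes at β_n and β is monotone.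

One integral operator performs exactly one step of this recursion. The Euler operator multiplies s^a
by the numerator of T. The exponential kernel is the Laguerre generating function, so the contour
integral turns v^a into L_{β_j-a}(w(1-t)(1-u)). Expanding this polynomial leaves beta integrals in t
and u, which supply the denominators of T and the rising factorials of R (`contourCoeff_mul_eq`,
`nestedIntegral_eq`).

For convergence, T_n = O(1/n) and S_n = O(β_n/n²) uniformly in the indices used. If β_n = o(n²), the
sums of absolute values pass the ratio test in n. Fubini then identifies the sum by `n` with the sum
by `m`. -/

/-! ### Rising factorials. -/

theorem poch_zero (a : ℂ) : poch a 0 = 1 := by simp [poch]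

theorem poch_succ (a : ℂ) (n : ℕ) : poch a (n + 1) = poch a n * (a + n) := by
  simp [poch, ascPochhammer_succ_eval]

theorem poch_add (a : ℂ) (m n : ℕ) : poch a (m + n) = poch a m * poch (a + m) n := by
  induction n with
  | zero => simp [poch_zero]
  | succ n ih => rw [← add_assoc, poch_succ, ih, poch_succ]; push_cast; ring

theorem poch_succ' (a : ℂ) (n : ℕ) : poch a (n + 1) = a * poch (a + 1) n := by
  rw [add_comm, poch_add, poch_succ, poch_zero]; simp

theorem poch_eq_prod (a : ℂ) (n : ℕ) : poch a n = ∏ j ∈ Finset.range n, (a + j) := by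
  induction n with
  | zero => simp [poch_zero]
  | succ n ih => rw [poch_succ, ih, Finset.prod_range_succ]

theorem poch_ne_zero_of_re_pos {a : ℂ} (ha : 0 < a.re) (n : ℕ) : poch a n ≠ 0 := by
  rw [poch_eq_prod, Finset.prod_ne_zero_iff]
  intro j _ h
  have := congrArg Complex.re h
  simp only [Complex.add_re, Complex.natCast_re, Complex.zero_re] at this
  have : (0 : ℝ) ≤ j := Nat.cast_nonneg j
  linarith

theorem poch_neg_natCast_eq_zero {N b : ℕ} (h : N < b) : poch (-(N : ℂ)) b = 0 := by
  rw [poch_eq_prod]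
  exact Finset.prod_eq_zero (Finset.mem_range.2 h) (by simp)

theorem poch_neg_natCast_ne_zero {N b : ℕ} (h : b ≤ N) : poch (-(N : ℂ)) b ≠ 0 := by
  rw [poch_eq_prod, Finset.prod_ne_zero_iff]
  intro j hj h0
  have h1 : (j : ℂ) = N := by linear_combination h0
  have h2 : j = N := by exact_mod_cast h1
  have := Finset.mem_range.1 hj
  omega

/-- Translates the binomial coefficients of the Laguerre polynomials into the rising factorials of
`pochRatio`. -/
theorem poch_neg_natCast (N k : ℕ) :
    poch (-(N : ℂ)) k = (-1) ^ k * (k.factorial : ℂ) * (N.choose k : ℂ) := by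
  induction k with
  | zero => simp [poch_zero]
  | succ k ih =>
    rw [poch_succ, ih]
    rcases le_or_gt k N with h | h
    · have h1 : ((N.choose (k + 1) : ℕ) : ℂ) * (k + 1) = N.choose k * ((N : ℂ) - k) := by
        have := Nat.choose_succ_right_eq N k
        rw [← Nat.cast_sub h]
        exact_mod_cast this
      rw [Nat.factorial_succ]
      push_cast
      linear_combination (-1) ^ k * (k.factorial : ℂ) * h1
    · rw [Nat.choose_eq_zero_of_lt h, Nat.choose_eq_zero_of_lt (h.trans (Nat.lt_succ_self k))]
      simp

/-! ### The recursion for the normalized coefficients. -/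

/-- The factor with which the passage from `n` to `n + 1` factors `A` multiplies the coefficient
with index `a`. -/
noncomputable def transferFactor (γ ω lam : ℂ) (n a : ℕ) : ℂ :=
  ((a : ℂ) + lam / 2 + ω / 2 + (n : ℂ) / 2)
    / (((a : ℂ) + 1 / 2 + lam / 2 + (n : ℂ) / 2) * ((a : ℂ) - 1 / 2 + γ + (n : ℂ) / 2 + lam / 2))

/-- The coefficients of the `n`-th sub-power series as a polynomial in `z`, up to normalization. -/
noncomputable def seriesCoeff (γ ω lam : ℂ) (β : ℕ → ℕ) : ℕ → ℕ → ℂ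
  | 0, b => poch (-(β 0 : ℂ)) b / (poch (1 + lam / 2) b * poch (γ + lam / 2) b)
  | n + 1, b => ∑ a ∈ Finset.range (b + 1),
      seriesCoeff γ ω lam β n a * (transferFactor γ ω lam n a * pochRatio γ lam β (n + 1) a b)

theorem pochRatio_eq_zero {γ lam : ℂ} {β : ℕ → ℕ} {k b : ℕ} (a : ℕ) (h : β k < b) :
    pochRatio γ lam β k a b = 0 := by
  simp [pochRatio, poch_neg_natCast_eq_zero h]

theorem seriesCoeff_eq_zero {γ ω lam : ℂ} {β : ℕ → ℕ} {n b : ℕ} (h : β n < b) :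
    seriesCoeff γ ω lam β n b = 0 := by
  cases n with
  | zero => simp [seriesCoeff, poch_neg_natCast_eq_zero h]
  | succ n =>
    rw [seriesCoeff]
    exact Finset.sum_eq_zero fun a _ => by rw [pochRatio_eq_zero a h]; simp

theorem re_pos_left {lam : ℂ} (ht : -1 < lam.re) (n : ℕ) :
    0 < (1 + (n : ℂ) / 2 + lam / 2).re := by
  have : (0 : ℝ) ≤ n := Nat.cast_nonneg n
  simp
  linarith

theorem re_pos_right {γ lam : ℂ} (hu : 0 < (γ - 1 / 2 + lam / 2).re) (n : ℕ) :
    0 < ((n : ℂ) / 2 + γ + lam / 2).re := by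
  have : (0 : ℝ) ≤ n := Nat.cast_nonneg n
  simp at hu ⊢
  linarith

/-- The quotient of consecutive coefficients of the `k`-th hypergeometric factor. -/
noncomputable def pochStep (γ lam : ℂ) (β : ℕ → ℕ) (k b : ℕ) : ℂ :=
  (-(β k : ℂ) + b) / ((1 + (k : ℂ) / 2 + lam / 2 + b) * ((k : ℂ) / 2 + γ + lam / 2 + b))

/-- As a function of `b`, the ratio solves the homogeneous two-term recurrence. No denominator has
to be nonzero. -/
theorem pochRatio_succ (γ lam : ℂ) (β : ℕ → ℕ) (k a b : ℕ) :
    pochRatio γ lam β k a (b + 1) = pochStep γ lam β k b * pochRatio γ lam β k a b := by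
  simp only [pochRatio, pochStep, poch_succ]
  rw [div_mul_div_comm]
  congr 1 <;> ring

theorem pochRatio_self {γ lam : ℂ} (ht : -1 < lam.re) (hu : 0 < (γ - 1 / 2 + lam / 2).re)
    {β : ℕ → ℕ} {k a : ℕ} (h : a ≤ β k) : pochRatio γ lam β k a a = 1 := by
  have h1 := poch_neg_natCast_ne_zero h
  have h2 := poch_ne_zero_of_re_pos (re_pos_left ht k) a
  have h3 := poch_ne_zero_of_re_pos (re_pos_right hu k) a
  exact div_self (mul_ne_zero (mul_ne_zero h1 h2) h3)

theorem seriesCoeff_zero_succ (γ ω lam : ℂ) (β : ℕ → ℕ) (b : ℕ) :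
    seriesCoeff γ ω lam β 0 (b + 1) = pochStep γ lam β 0 b * seriesCoeff γ ω lam β 0 b := by
  simp only [seriesCoeff, pochStep, poch_succ, Nat.cast_zero, zero_div, add_zero, zero_add]
  rw [div_mul_div_comm]
  congr 1 <;> ring

theorem seriesCoeff_succ_zero {γ lam : ℂ} (ht : -1 < lam.re)
    (hu : 0 < (γ - 1 / 2 + lam / 2).re) (ω : ℂ) (β : ℕ → ℕ) (n : ℕ) :
    seriesCoeff γ ω lam β (n + 1) 0 = transferFactor γ ω lam n 0 * seriesCoeff γ ω lam β n 0 := by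
  rw [seriesCoeff, zero_add, Finset.sum_range_one, pochRatio_self ht hu (Nat.zero_le _)]
  ring

/-- Variation of constants: the term `a = b + 1` of the defining sum is the inhomogeneity, and every
other term acquires the factor `pochStep`. -/
theorem seriesCoeff_succ_succ {γ lam : ℂ} (ht : -1 < lam.re)
    (hu : 0 < (γ - 1 / 2 + lam / 2).re) (ω : ℂ) {β : ℕ → ℕ} (hβ : Monotone β) (n b : ℕ) :
    seriesCoeff γ ω lam β (n + 1) (b + 1)
      = transferFactor γ ω lam n (b + 1) * seriesCoeff γ ω lam β n (b + 1)
        + pochStep γ lam β (n + 1) b * seriesCoeff γ ω lam β (n + 1) b := by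
  -- Beyond `β (n + 1)` the diagonal ratio is 0/0 = 0 instead of 1, but there the coefficient of
  -- level `n` vanishes by monotonicity of `β`.
  have h : seriesCoeff γ ω lam β n (b + 1) * (transferFactor γ ω lam n (b + 1)
        * pochRatio γ lam β (n + 1) (b + 1) (b + 1))
      = transferFactor γ ω lam n (b + 1) * seriesCoeff γ ω lam β n (b + 1) := by
    rcases le_or_gt (b + 1) (β (n + 1)) with hb | hb
    · rw [pochRatio_self ht hu hb]; ring
    · rw [seriesCoeff_eq_zero ((hβ (Nat.le_succ n)).trans_lt hb)]; ring
  rw [seriesCoeff, Finset.sum_range_succ, h, seriesCoeff, Finset.mul_sum, add_comm]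
  congr 1
  refine Finset.sum_congr rfl fun a _ => ?_
  rw [pochRatio_succ]
  ring

/-! ### The Frobenius coefficients. -/

section Frobenius

variable {μ ε ν ω lam c₀ : ℂ} {Ω : ℕ → ℂ}

theorem gchCoeff_zero_left (n : ℕ) :
    gchCoeff μ ε ν ω lam c₀ Ω 0 n = if n = 0 then c₀ else 0 := by
  rw [gchCoeff]

theorem gchCoeff_one (n : ℕ) : gchCoeff μ ε ν ω lam c₀ Ω 1 n
    = recA ε ν ω lam 0 * shiftRight (gchCoeff μ ε ν ω lam c₀ Ω 0) n := by
  rw [gchCoeff.eq_2]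

theorem gchCoeff_add_two (m n : ℕ) : gchCoeff μ ε ν ω lam c₀ Ω (m + 2) n
    = recA ε ν ω lam (m + 1) * shiftRight (gchCoeff μ ε ν ω lam c₀ Ω (m + 1)) n
        + recB μ ν lam (Ω n) (m + 1) * gchCoeff μ ε ν ω lam c₀ Ω m n := by
  rw [gchCoeff]

theorem gchCoeff_succ (m n : ℕ) : gchCoeff μ ε ν ω lam c₀ Ω (m + 1) n
    = recA ε ν ω lam m * shiftRight (gchCoeff μ ε ν ω lam c₀ Ω m) n
      + recB μ ν lam (Ω n) m * shiftRight (fun k => gchCoeff μ ε ν ω lam c₀ Ω k n) m := by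
  cases m with
  | zero => simp [gchCoeff_one, shiftRight]
  | succ m => rw [gchCoeff_add_two, shiftRight]

theorem gchCoeff_eq_zero_of_lt {m n : ℕ} (h : m < n) : gchCoeff μ ε ν ω lam c₀ Ω m n = 0 := by
  induction m using Nat.strong_induction_on generalizing n with
  | _ m ih =>
    obtain ⟨n, rfl⟩ : ∃ k, n = k + 1 := ⟨n - 1, by omega⟩
    cases m with
    | zero => simp [gchCoeff_zero_left]
    | succ m =>
      rw [gchCoeff_succ, shiftRight, ih m (by omega) (by omega)]
      cases m with
      | zero => simp [shiftRight]
      | succ m => simp [shiftRight, ih m (by omega) (show m < n + 1 by omega)]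

/-- Parity: `A` moves (m, n) by (1, 1) and `B` by (2, 0), so m - n remains even. -/
theorem gchCoeff_odd (n i : ℕ) : gchCoeff μ ε ν ω lam c₀ Ω (n + 2 * i + 1) n = 0 := by
  induction n generalizing i with
  | zero =>
    induction i with
    | zero => simp [gchCoeff_one, shiftRight]
    | succ i ih =>
      rw [show 0 + 2 * (i + 1) + 1 = (0 + 2 * i + 1) + 2 by ring, gchCoeff_add_two, ih]
      simp [shiftRight]
  | succ n ihn =>
    induction i with
    | zero =>
      have h := ihn 0
      rw [mul_zero, add_zero] at h
      rw [show n + 1 + 2 * 0 + 1 = n + 2 by ring, gchCoeff_add_two, shiftRight,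
        gchCoeff_eq_zero_of_lt (Nat.lt_succ_self n), h]
      simp
    | succ i ih =>
      rw [show n + 1 + 2 * (i + 1) + 1 = (n + 1 + 2 * i + 1) + 2 by ring, gchCoeff_add_two, ih,
        shiftRight, show n + 1 + 2 * i + 1 + 1 = n + 2 * (i + 1) + 1 by ring, ihn]
      simp

variable {β : ℕ → ℕ} {γ : ℂ}

theorem recA_eq (hγ : γ = 1 / 2 * (1 + ν)) (n i : ℕ) :
    recA ε ν ω lam (n + 2 * i) = -(1 / 2) * ε * transferFactor γ ω lam n i := by
  have h : ((n + 2 * i : ℕ) + 1 + lam) * ((n + 2 * i : ℕ) + ν + lam)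
      = 4 * (((i : ℂ) + 1 / 2 + lam / 2 + (n : ℂ) / 2)
        * ((i : ℂ) - 1 / 2 + γ + (n : ℂ) / 2 + lam / 2)) := by
    subst hγ; push_cast; ring
  rw [recA, transferFactor, h, mul_div_assoc', mul_comm (4 : ℂ), ← div_div, div_right_comm]
  congr 1
  push_cast
  ring

/-- The choice of `Ω n` turns the numerator into 2μ(i - β_n) up to sign, which vanishes at `i = β
n`; the denominator is 4 times that of `pochStep`. -/
theorem recB_eq (hγ : γ = 1 / 2 * (1 + ν))
    (hΩ : ∀ i : ℕ, Ω i = -μ * (2 * (β i : ℂ) + (i : ℂ) + lam)) (n i : ℕ) :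
    recB μ ν lam (Ω n) (n + 2 * i + 1) = -(1 / 2) * μ * pochStep γ lam β n i := by
  have h : ((n + 2 * i + 1 : ℕ) + 1 + lam) * ((n + 2 * i + 1 : ℕ) + ν + lam)
      = 4 * ((1 + (n : ℂ) / 2 + lam / 2 + i) * ((n : ℂ) / 2 + γ + lam / 2 + i)) := by
    subst hγ; push_cast; ring
  rw [recB, pochStep, h, mul_div_assoc', mul_comm (4 : ℂ), ← div_div, div_right_comm, hΩ]
  congr 1
  push_cast
  ring

theorem gchCoeff_even (hγ : γ = 1 / 2 * (1 + ν)) (ht : -1 < lam.re)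
    (hu : 0 < (γ - 1 / 2 + lam / 2).re) (hβ : Monotone β)
    (hΩ : ∀ i : ℕ, Ω i = -μ * (2 * (β i : ℂ) + (i : ℂ) + lam)) (n i : ℕ) :
    gchCoeff μ ε ν ω lam c₀ Ω (n + 2 * i) n
      = c₀ * (-(1 / 2) * ε) ^ n * (-(1 / 2) * μ) ^ i * seriesCoeff γ ω lam β n i := by
  induction n generalizing i with
  | zero =>
    induction i with
    | zero => simp [gchCoeff_zero_left, seriesCoeff, poch_zero]
    | succ i ih =>
      have hB := recB_eq hγ hΩ 0 i
      rw [zero_add] at hB ih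
      rw [show 0 + 2 * (i + 1) = 2 * i + 2 by ring, gchCoeff_add_two, ih, hB,
        seriesCoeff_zero_succ, shiftRight]
      ring
  | succ n ihn =>
    induction i with
    | zero =>
      -- The `B`-term would come from index n - 1 with n + 1 factors `A`, which is impossible.
      have h : shiftRight (fun k => gchCoeff μ ε ν ω lam c₀ Ω k (n + 1)) n = 0 := by
        cases n with
        | zero => rfl
        | succ n => exact gchCoeff_eq_zero_of_lt (by omega)
      have hA := recA_eq (ε := ε) (ω := ω) (lam := lam) hγ n 0
      have hI := ihn 0
      rw [mul_zero, add_zero] at hA hI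
      rw [show n + 1 + 2 * 0 = n + 1 by ring, gchCoeff_succ, h, shiftRight, hA, hI,
        seriesCoeff_succ_zero ht hu]
      ring
    | succ i ih =>
      rw [show n + 1 + 2 * (i + 1) = (n + 1 + 2 * i) + 2 by ring, gchCoeff_add_two, ih,
        shiftRight, recB_eq hγ hΩ, show n + 1 + 2 * i + 1 = n + 2 * (i + 1) by ring, ihn,
        recA_eq hγ, seriesCoeff_succ_succ ht hu ω hβ]
      ring

theorem gchCoeff_eq_zero_of_gt (hγ : γ = 1 / 2 * (1 + ν)) (ht : -1 < lam.re)
    (hu : 0 < (γ - 1 / 2 + lam / 2).re) (hβ : Monotone β)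
    (hΩ : ∀ i : ℕ, Ω i = -μ * (2 * (β i : ℂ) + (i : ℂ) + lam)) {n m : ℕ}
    (h : n + 2 * β n < m) : gchCoeff μ ε ν ω lam c₀ Ω m n = 0 := by
  obtain ⟨i, hi | hi⟩ : ∃ i, m = n + 2 * i ∨ m = n + 2 * i + 1 := ⟨(m - n) / 2, by omega⟩
  · rw [hi, gchCoeff_even hγ ht hu hβ hΩ, seriesCoeff_eq_zero (by omega), mul_zero]
  · rw [hi, gchCoeff_odd]

/-- The polynomial with the coefficients `seriesCoeff`. -/
noncomputable def seriesPoly (γ ω lam : ℂ) (β : ℕ → ℕ) (n : ℕ) (z : ℂ) : ℂ :=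
  ∑ b ∈ Finset.range (β n + 1), seriesCoeff γ ω lam β n b * z ^ b

theorem gchSub_eq (hγ : γ = 1 / 2 * (1 + ν)) (ht : -1 < lam.re)
    (hu : 0 < (γ - 1 / 2 + lam / 2).re) (hβ : Monotone β)
    (hΩ : ∀ i : ℕ, Ω i = -μ * (2 * (β i : ℂ) + (i : ℂ) + lam)) (n : ℕ) (x : ℂ) :
    gchSub μ ε ν ω lam c₀ Ω n x
      = c₀ * x ^ lam * (seriesPoly γ ω lam β n (-(1 / 2) * μ * x ^ 2)
        * (-(1 / 2) * ε * x) ^ n) := by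
  have hinj : Function.Injective fun i : ℕ => n + 2 * i := fun i j h => by
    simp only at h; omega
  have hsupp : Function.support (fun m => gchCoeff μ ε ν ω lam c₀ Ω m n * x ^ m)
      ⊆ Set.range fun i : ℕ => n + 2 * i := by
    intro m hm
    by_contra hr
    refine hm ?_
    rcases lt_or_ge m n with h | h
    · simp [gchCoeff_eq_zero_of_lt h]
    · obtain ⟨i, hi | hi⟩ : ∃ i, m = n + 2 * i ∨ m = n + 2 * i + 1 := ⟨(m - n) / 2, by omega⟩
      · exact absurd ⟨i, hi.symm⟩ hr
      · simp [hi, gchCoeff_odd]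
  rw [gchSub, ← hinj.tsum_eq hsupp, tsum_eq_sum (s := Finset.range (β n + 1)), seriesPoly,
    Finset.sum_mul, Finset.mul_sum, Finset.mul_sum]
  · refine Finset.sum_congr rfl fun i _ => ?_
    rw [gchCoeff_even hγ ht hu hβ hΩ, pow_add, pow_mul, mul_pow _ (x ^ 2), mul_pow _ x]
    ring
  · intro i hi
    rw [gchCoeff_even hγ ht hu hβ hΩ, seriesCoeff_eq_zero]
    · simp
    · simp at hi; omega

end Frobenius

/-! ### The nested sum. -/

section ClosedForm

variable (γ ω lam : ℂ) (β : ℕ → ℕ)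

/-- The index set of the nested sum. -/
def chainSet (n : ℕ) : Finset (Fin (n + 1) → ℕ) :=
  (Fintype.piFinset fun k : Fin (n + 1) => Finset.range (β k + 1)).filter
    fun i => ∀ k : Fin n, i k.castSucc ≤ i k.succ

/-- The weight of an index of the nested sum. -/
noncomputable def chainWeight (n : ℕ) (i : Fin (n + 1) → ℕ) : ℂ :=
  poch (-(β 0 : ℂ)) (i 0) / (poch (1 + lam / 2) (i 0) * poch (γ + lam / 2) (i 0))
    * ∏ k : Fin n, transferFactor γ ω lam k (i k.castSucc)
        * pochRatio γ lam β (k + 1) (i k.castSucc) (i k.succ)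

theorem chainWeight_snoc (n : ℕ) (i : Fin (n + 1) → ℕ) (b : ℕ) :
    chainWeight γ ω lam β (n + 1) (Fin.snoc (α := fun _ => ℕ) i b)
      = chainWeight γ ω lam β n i * (transferFactor γ ω lam n (i (Fin.last n))
          * pochRatio γ lam β (n + 1) (i (Fin.last n)) b) := by
  have h0 : (Fin.snoc (α := fun _ => ℕ) i b) 0 = i 0 := by
    rw [← Fin.castSucc_zero, Fin.snoc_castSucc]
  rw [chainWeight, Fin.prod_univ_castSucc, h0, chainWeight, mul_assoc]
  simp only [Fin.snoc_castSucc, Fin.succ_castSucc, Fin.succ_last, Fin.snoc_last,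
    Fin.val_castSucc, Fin.val_last]

variable {β} in
theorem snoc_mem_chainSet {n : ℕ} {i : Fin (n + 1) → ℕ} {b : ℕ} :
    Fin.snoc (α := fun _ => ℕ) i b ∈ chainSet β (n + 1)
      ↔ i ∈ chainSet β n ∧ b < β (n + 1) + 1 ∧ i (Fin.last n) ≤ b := by
  simp only [chainSet, Finset.mem_filter, Fintype.mem_piFinset, Finset.mem_range]
  rw [Fin.forall_fin_succ', Fin.forall_fin_succ' (n := n) (P := fun k =>
    Fin.snoc (α := fun _ => ℕ) i b k.castSucc ≤ Fin.snoc (α := fun _ => ℕ) i b k.succ)]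
  simp only [Fin.snoc_castSucc, Fin.succ_castSucc, Fin.succ_last, Fin.snoc_last,
    Fin.val_castSucc, Fin.val_last]
  tauto

theorem sum_chainSet_succ (n : ℕ) (F : (Fin (n + 2) → ℕ) → ℂ) :
    ∑ i ∈ chainSet β (n + 1), F i
      = ∑ b ∈ Finset.range (β (n + 1) + 1), ∑ i ∈ chainSet β n,
          if i (Fin.last n) ≤ b then F (Fin.snoc (α := fun _ => ℕ) i b) else 0 := by
  rw [← Finset.sum_product', ← Finset.sum_filter]
  symm
  refine Finset.sum_nbij' (fun p => Fin.snoc (α := fun _ => ℕ) p.2 p.1)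
    (fun i => (i (Fin.last _), Fin.init (α := fun _ => ℕ) i)) ?_ ?_ ?_ ?_ ?_
  · intro p hp
    simp only [Finset.mem_filter, Finset.mem_product, Finset.mem_range] at hp
    exact snoc_mem_chainSet.2 ⟨hp.1.2, hp.1.1, hp.2⟩
  · intro i hi
    rw [← Fin.snoc_init_self (α := fun _ => ℕ) i, snoc_mem_chainSet] at hi
    simp only [Finset.mem_filter, Finset.mem_product, Finset.mem_range]
    exact ⟨⟨hi.2.1, hi.1⟩, hi.2.2⟩
  · intro p _
    simp
  · intro i _
    exact Fin.snoc_init_self (α := fun _ => ℕ) i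
  · intro p _
    rfl

/-- The test function `g` is arbitrary so that the induction can absorb the last index, including
its constraint, into it. -/
theorem sum_chainWeight (n : ℕ) (g : ℕ → ℂ) :
    ∑ i ∈ chainSet β n, chainWeight γ ω lam β n i * g (i (Fin.last n))
      = ∑ b ∈ Finset.range (β n + 1), seriesCoeff γ ω lam β n b * g b := by
  induction n generalizing g with
  | zero =>
    refine Finset.sum_nbij' (fun i => i 0) (fun b _ => b) ?_ ?_ ?_ ?_ ?_
    · intro i hi
      simpa [chainSet] using hi
    · intro b hb
      simpa [chainSet] using hb
    · intro i _
      funext k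
      rw [Fin.eq_zero k]
    · intro b _
      rfl
    · intro i _
      simp [chainWeight, seriesCoeff]
  | succ n ih =>
    rw [sum_chainSet_succ]
    refine Finset.sum_congr rfl fun b _ => ?_
    have h := ih fun a => if a ≤ b then
      transferFactor γ ω lam n a * pochRatio γ lam β (n + 1) a b * g b else 0
    calc _ = _ := Finset.sum_congr rfl fun i _ => ?_
      _ = _ := h
      _ = _ := ?_
    · rw [chainWeight_snoc, Fin.snoc_last, mul_ite, mul_zero]
      split_ifs
      · ring
      · rfl
    · rw [seriesCoeff, Finset.sum_mul]
      simp only [mul_ite, mul_zero]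
      rw [← Finset.sum_filter]
      -- One side has a ≤ min(b, β_n), the other a ≤ b; the surplus coefficients vanish.
      refine Finset.sum_subset_zero_on_sdiff ?_ ?_ ?_
      · intro a ha
        simp only [Finset.mem_filter, Finset.mem_range] at ha ⊢
        omega
      · intro a ha
        simp only [Finset.mem_sdiff, Finset.mem_filter, Finset.mem_range] at ha
        rw [seriesCoeff_eq_zero (by omega)]
        simp
      · intro a _
        ring

theorem gchClosedSum_eq (n : ℕ) (z : ℂ) :
    gchClosedSum γ ω lam β n z = seriesPoly γ ω lam β n z :=
  sum_chainWeight γ ω lam β n fun b => z ^ b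

end ClosedForm

/-! ### Laguerre polynomials and the contour integral. -/

open scoped Real

/-- The Laguerre polynomial `L_N`. -/
noncomputable def laguerreSum (N : ℕ) (X : ℂ) : ℂ :=
  ∑ k ∈ Finset.range (N + 1), (N.choose k : ℂ) * (-X) ^ k / k.factorial

theorem one_sub_ne_zero_of_norm_lt_one {v : ℂ} (hv : ‖v‖ < 1) : 1 - v ≠ 0 := by
  intro h
  rw [← sub_eq_zero.1 h] at hv
  simp at hv

/-- The absolutely convergent double series `F` is summed in two ways: over l first, it gives the
exponential series divided by 1 - v; along k + l = N, it gives L_N(X) v^N. -/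
theorem hasSum_laguerreSum_mul_pow (X : ℂ) {v : ℂ} (hv : ‖v‖ < 1) :
    HasSum (fun N => laguerreSum N X * v ^ N) (Complex.exp (-(v / (1 - v)) * X) / (1 - v)) := by
  set F : ℕ × ℕ → ℂ := fun p =>
    ((-X * v) ^ p.1 / p.1.factorial) * (((p.2 + p.1).choose p.1 : ℂ) * v ^ p.2) with hF
  have hrow : ∀ k, HasSum (fun l => F (k, l))
      ((-X * v) ^ k / k.factorial * (1 / (1 - v) ^ (k + 1))) :=
    fun k => (hasSum_choose_mul_geometric_of_norm_lt_one k hv).mul_left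
      ((-X * v) ^ k / k.factorial)
  have hnv : ‖(‖v‖ : ℝ)‖ < 1 := by simpa using hv
  have hrown : ∀ k, HasSum (fun l => ‖F (k, l)‖)
      ((‖X‖ * ‖v‖) ^ k / k.factorial * (1 / (1 - ‖v‖) ^ (k + 1))) := by
    intro k
    have := (hasSum_choose_mul_geometric_of_norm_lt_one k hnv).mul_left
      ((‖X‖ * ‖v‖) ^ k / k.factorial)
    rw [show (fun l => ‖F (k, l)‖) = fun l => (‖X‖ * ‖v‖) ^ k / k.factorial
      * (((l + k).choose k : ℝ) * ‖v‖ ^ l) from funext fun l => by simp [hF]]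
    exact this
  have hsum : Summable F := by
    refine Summable.of_norm ?_
    rw [summable_prod_of_nonneg fun p => norm_nonneg _]
    refine ⟨fun k => (hrown k).summable, ?_⟩
    simp only [(hrown _).tsum_eq]
    have := (Real.summable_pow_div_factorial (‖X‖ * ‖v‖ / (1 - ‖v‖))).mul_right (1 / (1 - ‖v‖))
    refine this.congr fun k => ?_
    rw [div_pow, pow_succ, one_div, one_div, mul_inv]
    ring
  have hexp : HasSum (fun k : ℕ => (-X * v) ^ k / k.factorial * (1 / (1 - v) ^ (k + 1)))
      (Complex.exp (-(v / (1 - v)) * X) / (1 - v)) := by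
    have := (NormedSpace.expSeries_div_hasSum_exp (-(v / (1 - v)) * X)).div_const (1 - v)
    rw [← Complex.exp_eq_exp_ℂ] at this
    rw [show (fun k : ℕ => (-X * v) ^ k / k.factorial * (1 / (1 - v) ^ (k + 1)))
      = fun k : ℕ => (-(v / (1 - v)) * X) ^ k / k.factorial / (1 - v) from funext fun k => by
        rw [show -(v / (1 - v)) * X = (-X * v) / (1 - v) by ring, div_pow, pow_succ, one_div,
          mul_inv]
        ring]
    exact this
  have htot : HasSum F (Complex.exp (-(v / (1 - v)) * X) / (1 - v)) := by
    have := hsum.hasSum.prod_fiberwise hrow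
    rw [← this.unique hexp]
    exact hsum.hasSum
  rw [← Finset.HasAntidiagonal.sigmaAntidiagonalEquivProd.hasSum_iff] at htot
  convert htot.sigma fun N => hasSum_fintype _ using 1
  funext N
  rw [Finset.univ_eq_attach, laguerreSum, Finset.sum_mul]
  simp only [Function.comp_apply, Finset.HasAntidiagonal.sigmaAntidiagonalEquivProd_apply]
  rw [Finset.sum_attach _ F, Finset.Nat.sum_antidiagonal_eq_sum_range_succ_mk]
  refine Finset.sum_congr rfl fun k hk => ?_
  have hk' : k ≤ N := Nat.lt_succ_iff.1 (Finset.mem_range.1 hk)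
  simp only [hF]
  rw [Nat.sub_add_cancel hk', ← Nat.sub_add_cancel hk', pow_add v, mul_pow]
  simp only [Nat.sub_add_cancel hk']
  ring

/-- The left side is a Cauchy coefficient of the generating function; uniqueness of power series
identifies it. -/
theorem two_pi_I_inv_mul_circleIntegral_exp_div (X : ℂ) (N : ℕ) {r : ℝ} (h0 : 0 < r)
    (h1 : r < 1) :
    1 / (2 * (π : ℂ) * Complex.I) *
      ∮ v in C(0, r), Complex.exp (-(v / (1 - v)) * X) / (v ^ (N + 1) * (1 - v))
      = laguerreSum N X := by
  lift r to NNReal using h0.le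
  set g : ℂ → ℂ := fun v => Complex.exp (-(v / (1 - v)) * X) / (1 - v) with hg
  have hdiff : DifferentiableOn ℂ g (Metric.closedBall 0 (r : ℝ)) := by
    intro v hv
    have hv1 : 1 - v ≠ 0 := one_sub_ne_zero_of_norm_lt_one
      ((by simpa using hv : ‖v‖ ≤ r).trans_lt h1)
    refine DifferentiableAt.differentiableWithinAt ?_
    fun_prop (disch := assumption)
  have hp := (hdiff.hasFPowerSeriesOnBall (by exact_mod_cast h0)).hasFPowerSeriesAt
  have hq : HasFPowerSeriesAt g
      (FormalMultilinearSeries.ofScalars ℂ fun N => laguerreSum N X) 0 := by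
    rw [hasFPowerSeriesAt_iff]
    filter_upwards [Metric.ball_mem_nhds (0 : ℂ) one_pos] with v hv
    simp only [FormalMultilinearSeries.coeff_ofScalars, smul_eq_mul, zero_add]
    simp only [mul_comm (v ^ _)]
    exact hasSum_laguerreSum_mul_pow X (by simpa using hv)
  have h := congrArg (fun p => p.coeff N) (hp.eq_formalMultilinearSeries hq)
  simp only [FormalMultilinearSeries.coeff_ofScalars] at h
  rw [← h, FormalMultilinearSeries.coeff]
  have h2 := cauchyPowerSeries_apply g 0 r N 1
  rw [show (1 : Fin N → ℂ) = fun _ => 1 from rfl, h2, smul_eq_mul, one_div]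
  congr 1
  refine circleIntegral.integral_congr r.2 fun v hv => ?_
  simp only [hg, smul_eq_mul, sub_zero, one_div, inv_pow, pow_succ]
  rw [div_eq_mul_inv, div_eq_mul_inv, mul_inv, mul_inv]
  ring

/-! ### One integral operator applied to a polynomial. -/

theorem eulerOp_sum (ω lam : ℂ) (j M : ℕ) (c : ℕ → ℂ) (s : ℂ) :
    eulerOp ω lam j (fun z => ∑ a ∈ Finset.range M, c a * z ^ a) s
      = ∑ a ∈ Finset.range M, (a + 1 / 2 * ((j : ℂ) - 1 + ω + lam)) * c a * s ^ a := by
  have h : deriv (fun z => ∑ a ∈ Finset.range M, c a * z ^ a) s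
      = ∑ a ∈ Finset.range M, c a * (a * s ^ (a - 1)) := by
    rw [deriv_fun_sum fun a _ => by fun_prop]
    exact Finset.sum_congr rfl fun a _ => by simp
  rw [eulerOp, h, Finset.mul_sum, Finset.mul_sum, ← Finset.sum_add_distrib]
  refine Finset.sum_congr rfl fun a _ => ?_
  cases a with
  | zero => simp
  | succ a => rw [Nat.add_sub_cancel]; ring

/-- Makes the range independent of the degree, so that the double sum runs over a product set. -/
theorem laguerreSum_eq_sum_range {N M : ℕ} (h : N ≤ M) (X : ℂ) :
    laguerreSum N X = ∑ k ∈ Finset.range (M + 1), (N.choose k : ℂ) * (-X) ^ k / k.factorial := by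
  refine Finset.sum_subset (Finset.range_mono (by omega)) fun k _ hk => ?_
  rw [Nat.choose_eq_zero_of_lt (by simp at hk; omega)]
  simp

theorem betaIntegral_natCast_succ {α : ℂ} (hα : 0 < α.re) (a k : ℕ) :
    Complex.betaIntegral (α + a) (k + 1) = k.factorial / poch (α + a) (k + 1) := by
  rw [Complex.betaIntegral_eval_nat_add_one_right, poch_eq_prod]
  simp only [Complex.add_re, Complex.natCast_re]
  positivity

theorem cpow_mul_pow_mul_one_sub_pow {α : ℂ} (a k : ℕ) {u : ℝ} (h : 0 < u) :
    (u : ℂ) ^ (α + a - 1) * (1 - (u : ℂ)) ^ ((k : ℂ) + 1 - 1)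
      = (u : ℂ) ^ (α - 1) * ((u : ℂ) ^ a * (1 - (u : ℂ)) ^ k) := by
  rw [add_sub_cancel_right, Complex.cpow_natCast, add_sub_right_comm,
    Complex.cpow_add _ _ (by exact_mod_cast h.ne'), Complex.cpow_natCast, mul_assoc]

theorem intervalIntegrable_cpow_mul_sum {α : ℂ} (hα : 0 < α.re) (S : Finset (ℕ × ℕ))
    (C : ℕ × ℕ → ℂ) :
    IntervalIntegrable (fun u : ℝ => (u : ℂ) ^ (α - 1)
      * ∑ p ∈ S, C p * ((u : ℂ) ^ p.1 * (1 - (u : ℂ)) ^ p.2)) MeasureTheory.volume 0 1 := by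
  have h : ∀ p ∈ S, IntervalIntegrable (fun u : ℝ => C p * ((u : ℂ) ^ (α + p.1 - 1)
      * (1 - (u : ℂ)) ^ ((p.2 : ℂ) + 1 - 1))) MeasureTheory.volume 0 1 := fun p _ =>
    (Complex.betaIntegral_convergent
      (by simp only [Complex.add_re, Complex.natCast_re]; positivity)
      (by simp only [Complex.add_re, Complex.natCast_re, Complex.one_re]; positivity)).const_mul _
  refine (IntervalIntegrable.sum S h).congr fun u hu => ?_
  rw [Set.uIoc_of_le zero_le_one] at hu
  rw [Finset.sum_apply, Finset.mul_sum]
  refine Finset.sum_congr rfl fun p _ => ?_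
  rw [cpow_mul_pow_mul_one_sub_pow _ _ hu.1]
  ring

theorem integral_cpow_mul_sum {α : ℂ} (hα : 0 < α.re) (S : Finset (ℕ × ℕ))
    (C : ℕ × ℕ → ℂ) :
    ∫ u in (0 : ℝ)..1, (u : ℂ) ^ (α - 1)
      * ∑ p ∈ S, C p * ((u : ℂ) ^ p.1 * (1 - (u : ℂ)) ^ p.2)
      = ∑ p ∈ S, C p * (p.2.factorial / poch (α + p.1) (p.2 + 1)) := by
  have h : ∀ p ∈ S, IntervalIntegrable (fun u : ℝ => C p * ((u : ℂ) ^ (α + p.1 - 1)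
      * (1 - (u : ℂ)) ^ ((p.2 : ℂ) + 1 - 1))) MeasureTheory.volume 0 1 := fun p _ =>
    (Complex.betaIntegral_convergent
      (by simp only [Complex.add_re, Complex.natCast_re]; positivity)
      (by simp only [Complex.add_re, Complex.natCast_re, Complex.one_re]; positivity)).const_mul _
  have h2 : ∫ u in (0 : ℝ)..1, (u : ℂ) ^ (α - 1)
      * ∑ p ∈ S, C p * ((u : ℂ) ^ p.1 * (1 - (u : ℂ)) ^ p.2)
      = ∫ u in (0 : ℝ)..1, ∑ p ∈ S, C p * ((u : ℂ) ^ (α + p.1 - 1)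
      * (1 - (u : ℂ)) ^ ((p.2 : ℂ) + 1 - 1)) := by
    -- Splitting the complex power needs u ≠ 0, hence the comparison on (0, 1] only.
    refine intervalIntegral.integral_congr_ae (Filter.Eventually.of_forall fun u hu => ?_)
    rw [Set.uIoc_of_le zero_le_one] at hu
    rw [Finset.mul_sum]
    refine Finset.sum_congr rfl fun p _ => ?_
    rw [cpow_mul_pow_mul_one_sub_pow _ _ hu.1]
    ring
  rw [h2, intervalIntegral.integral_finsetSum h]
  refine Finset.sum_congr rfl fun p _ => ?_
  rw [intervalIntegral.integral_const_mul, ← betaIntegral_natCast_succ hα]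
  rfl

section Operator

variable {γ ω lam : ℂ} {β : ℕ → ℕ} {r : ℕ → ℝ} {j M : ℕ} (c : ℕ → ℂ) (w : ℂ)

theorem continuousOn_exp_div (X : ℂ) (N : ℕ) {ρ : ℝ} (h0 : 0 < ρ) (h1 : ρ < 1) :
    ContinuousOn (fun v : ℂ => Complex.exp (-(v / (1 - v)) * X) / (v ^ (N + 1) * (1 - v)))
      (Metric.sphere 0 ρ) := by
  intro v hv
  have hv' : ‖v‖ = ρ := by simpa using hv
  have hv0 : v ^ (N + 1) * (1 - v) ≠ 0 :=
    mul_ne_zero (pow_ne_zero _ (norm_pos_iff.1 (by rw [hv']; exact h0)))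
      (one_sub_ne_zero_of_norm_lt_one (by rw [hv']; exact h1))
  have hv1 : 1 - v ≠ 0 := right_ne_zero_of_mul hv0
  refine ContinuousAt.continuousWithinAt ?_
  fun_prop (disch := assumption)

/-- The monomial of degree `a` contributes v^a and lowers the pole order; `M ≤ β j` keeps β_j - a a
genuine difference. -/
theorem vIntegrand_eqOn (hr : 0 < r j) (hM : M ≤ β j) (t u : ℝ) :
    Set.EqOn (vIntegrand ω lam β j (fun z => ∑ a ∈ Finset.range (M + 1), c a * z ^ a) w t u)
      (fun v => ∑ a ∈ Finset.range (M + 1),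
        ((a + 1 / 2 * ((j : ℂ) - 1 + ω + lam)) * c a * (w * t * u) ^ a)
          * (Complex.exp (-(v / (1 - v)) * (w * (1 - t) * (1 - u)))
            / (v ^ (β j - a + 1) * (1 - v))))
      (Metric.sphere 0 (r j)) := by
  intro v hv
  have hv' : ‖v‖ = r j := by simpa using hv
  have hv0 : v ≠ 0 := norm_pos_iff.1 (by rw [hv']; exact hr)
  simp only [vIntegrand]
  rw [eulerOp_sum, Finset.mul_sum]
  refine Finset.sum_congr rfl fun a ha => ?_
  have ha' : a ≤ β j := (Nat.lt_succ_iff.1 (Finset.mem_range.1 ha)).trans hM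
  rw [show β j + 1 = (β j - a + 1) + a by omega, pow_add v, mul_pow _ v,
    show -(v / (1 - v)) * w * (1 - (t : ℂ)) * (1 - (u : ℂ))
      = -(v / (1 - v)) * (w * (1 - t) * (1 - u)) by ring, mul_right_comm _ (v ^ a), ← div_div,
    show ∀ E : ℂ, E / v ^ a * ((a + 1 / 2 * ((j : ℂ) - 1 + ω + lam)) * c a
        * ((w * t * u) ^ a * v ^ a)) = (a + 1 / 2 * ((j : ℂ) - 1 + ω + lam)) * c a
        * (w * t * u) ^ a * (E * (v ^ a / v ^ a)) from fun E => by ring,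
    div_self (pow_ne_zero _ hv0), mul_one]

theorem circleIntegrable_vIntegrand (hr : 0 < r j ∧ r j < 1) (hM : M ≤ β j) (t u : ℝ) :
    CircleIntegrable (vIntegrand ω lam β j (fun z => ∑ a ∈ Finset.range (M + 1), c a * z ^ a)
      w t u) 0 (r j) := by
  refine ContinuousOn.circleIntegrable hr.1.le ?_
  refine ContinuousOn.congr ?_ (vIntegrand_eqOn c w hr.1 hM t u)
  exact continuousOn_finsetSum _ fun a _ =>
    continuousOn_const.mul (continuousOn_exp_div _ _ hr.1 hr.2)

theorem circleIntegral_vIntegrand (hr : 0 < r j ∧ r j < 1) (hM : M ≤ β j) (t u : ℝ) :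
    1 / (2 * (Real.pi : ℂ) * Complex.I) * ∮ v in C(0, r j), vIntegrand ω lam β j
        (fun z => ∑ a ∈ Finset.range (M + 1), c a * z ^ a) w t u v
      = ∑ a ∈ Finset.range (M + 1), ((a + 1 / 2 * ((j : ℂ) - 1 + ω + lam)) * c a
          * (w * t * u) ^ a) * laguerreSum (β j - a) (w * (1 - t) * (1 - u)) := by
  rw [circleIntegral.integral_congr hr.1.le (vIntegrand_eqOn c w hr.1 hM t u),
    circleIntegral.integral_fun_sum, Finset.mul_sum]
  · refine Finset.sum_congr rfl fun a _ => ?_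
    rw [circleIntegral.integral_const_mul, mul_left_comm,
      two_pi_I_inv_mul_circleIntegral_exp_div _ _ hr.1 hr.2]
  · exact fun a _ => ContinuousOn.circleIntegrable hr.1.le
      (continuousOn_const.mul (continuousOn_exp_div _ _ hr.1 hr.2))

/-- The coefficients of the contour integral as a polynomial in the integration variables. -/
noncomputable def contourCoeff (ω lam : ℂ) (j B : ℕ) (c : ℕ → ℂ) (w : ℂ) (p : ℕ × ℕ) : ℂ :=
  (p.1 + 1 / 2 * ((j : ℂ) - 1 + ω + lam)) * c p.1 * ((-1) ^ p.2 * ((B - p.1).choose p.2 : ℂ))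
    / p.2.factorial * w ^ (p.1 + p.2)

theorem circleIntegral_vIntegrand_eq_sum (hr : 0 < r j ∧ r j < 1) (hM : M ≤ β j) (t u : ℝ) :
    1 / (2 * (Real.pi : ℂ) * Complex.I) * ∮ v in C(0, r j), vIntegrand ω lam β j
        (fun z => ∑ a ∈ Finset.range (M + 1), c a * z ^ a) w t u v
      = ∑ p ∈ Finset.range (M + 1) ×ˢ Finset.range (β j + 1),
          contourCoeff ω lam j (β j) c w p * ((t : ℂ) ^ p.1 * (1 - (t : ℂ)) ^ p.2)
            * ((u : ℂ) ^ p.1 * (1 - (u : ℂ)) ^ p.2) := by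
  rw [circleIntegral_vIntegrand c w hr hM, Finset.sum_product]
  refine Finset.sum_congr rfl fun a _ => ?_
  rw [laguerreSum_eq_sum_range (Nat.sub_le (β j) a), Finset.mul_sum]
  refine Finset.sum_congr rfl fun k _ => ?_
  simp only [contourCoeff]
  rw [pow_add, show -(w * (1 - (t : ℂ)) * (1 - (u : ℂ)))
    = (-1) * (w * ((1 - (t : ℂ)) * (1 - (u : ℂ)))) by ring]
  simp only [mul_pow]
  ring

theorem uIntegrand_eq_sum (hr : 0 < r j ∧ r j < 1) (hM : M ≤ β j) (t : ℝ) :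
    uIntegrand γ ω lam β r j (fun z => ∑ a ∈ Finset.range (M + 1), c a * z ^ a) w t
      = fun u : ℝ => (u : ℂ) ^ (γ + (j : ℂ) / 2 - 1 + lam / 2 - 1)
        * ∑ p ∈ Finset.range (M + 1) ×ˢ Finset.range (β j + 1),
          contourCoeff ω lam j (β j) c w p * ((t : ℂ) ^ p.1 * (1 - (t : ℂ)) ^ p.2)
            * ((u : ℂ) ^ p.1 * (1 - (u : ℂ)) ^ p.2) := by
  funext u
  rw [uIntegrand, circleIntegral_vIntegrand_eq_sum c w hr hM,
    show γ + (j : ℂ) / 2 - 2 + lam / 2 = γ + (j : ℂ) / 2 - 1 + lam / 2 - 1 by ring]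

theorem tIntegrand_eq_sum (hα : 0 < (γ + (j : ℂ) / 2 - 1 + lam / 2).re)
    (hr : 0 < r j ∧ r j < 1) (hM : M ≤ β j) :
    tIntegrand γ ω lam β r j (fun z => ∑ a ∈ Finset.range (M + 1), c a * z ^ a) w
      = fun t : ℝ => (t : ℂ) ^ ((j : ℂ) / 2 + lam / 2 - 1)
        * ∑ p ∈ Finset.range (M + 1) ×ˢ Finset.range (β j + 1),
          contourCoeff ω lam j (β j) c w p
            * (p.2.factorial / poch (γ + (j : ℂ) / 2 - 1 + lam / 2 + p.1) (p.2 + 1))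
            * ((t : ℂ) ^ p.1 * (1 - (t : ℂ)) ^ p.2) := by
  funext t
  rw [tIntegrand, uIntegrand_eq_sum c w hr hM, integral_cpow_mul_sum hα,
    show (j : ℂ) / 2 - 1 + lam / 2 = (j : ℂ) / 2 + lam / 2 - 1 by ring]
  congr 1
  exact Finset.sum_congr rfl fun p _ => by ring

end Operator

/-- The first factor of each rising factorial of length k + 1 is a denominator of `transferFactor`;
the remaining k factors are quotients (·)_{a+k}/(·)_a, as is (-1)^k k! C(β_{n+1}-a, k). -/
theorem contourCoeff_mul_eq {γ ω lam : ℂ} {β : ℕ → ℕ} (hβ : Monotone β) (ht : -1 < lam.re)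
    (hu : 0 < (γ - 1 / 2 + lam / 2).re) (n : ℕ) (c : ℕ → ℂ) (w : ℂ) {a k : ℕ} (ha : a ≤ β n) :
    contourCoeff ω lam (n + 1) (β (n + 1)) c w (a, k)
        * (k.factorial / poch (γ + ((n + 1 : ℕ) : ℂ) / 2 - 1 + lam / 2 + a) (k + 1))
        * (k.factorial / poch (((n + 1 : ℕ) : ℂ) / 2 + lam / 2 + a) (k + 1))
      = c a * (transferFactor γ ω lam n a * pochRatio γ lam β (n + 1) a (a + k)) * w ^ (a + k) := by
  have ha' : a ≤ β (n + 1) := ha.trans (hβ (Nat.le_succ n))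
  have h1 := poch_neg_natCast_ne_zero ha'
  have h2 := poch_ne_zero_of_re_pos (re_pos_left ht (n + 1)) a
  have h3 := poch_ne_zero_of_re_pos (re_pos_right hu (n + 1)) a
  have hk := poch_neg_natCast (β (n + 1) - a) k
  rw [Nat.cast_sub ha', neg_sub, sub_eq_add_neg, add_comm] at hk
  have hf : (k.factorial : ℂ) ≠ 0 := by exact_mod_cast k.factorial_ne_zero
  simp only [contourCoeff, pochRatio, transferFactor]
  rw [poch_succ', poch_succ', poch_add (-(β (n + 1) : ℂ)) a, hk, poch_add _ a, poch_add _ a,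
    show γ + ((n + 1 : ℕ) : ℂ) / 2 - 1 + lam / 2 + a + 1
      = ((n + 1 : ℕ) : ℂ) / 2 + γ + lam / 2 + a by ring,
    show ((n + 1 : ℕ) : ℂ) / 2 + lam / 2 + a + 1 = 1 + ((n + 1 : ℕ) : ℂ) / 2 + lam / 2 + a by ring,
    show γ + ((n + 1 : ℕ) : ℂ) / 2 - 1 + lam / 2 + a
      = (a : ℂ) - 1 / 2 + γ + (n : ℂ) / 2 + lam / 2 by push_cast; ring,
    show ((n + 1 : ℕ) : ℂ) / 2 + lam / 2 + a
      = (a : ℂ) + 1 / 2 + lam / 2 + (n : ℂ) / 2 by push_cast; ring,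
    show (a : ℂ) + 1 / 2 * (((n + 1 : ℕ) : ℂ) - 1 + ω + lam)
      = (a : ℂ) + lam / 2 + ω / 2 + (n : ℂ) / 2 by push_cast; ring]
  -- Only `q6`, `q7`, `q8` and k! have to cancel; the other denominators occur alike on both sides.
  generalize (a : ℂ) + 1 / 2 + lam / 2 + (n : ℂ) / 2 = q1
  generalize (a : ℂ) - 1 / 2 + γ + (n : ℂ) / 2 + lam / 2 = q2
  generalize (a : ℂ) + lam / 2 + ω / 2 + (n : ℂ) / 2 = q3
  generalize poch (1 + ((n + 1 : ℕ) : ℂ) / 2 + lam / 2 + a) k = q4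
  generalize poch (((n + 1 : ℕ) : ℂ) / 2 + γ + lam / 2 + a) k = q5
  generalize poch (1 + ((n + 1 : ℕ) : ℂ) / 2 + lam / 2) a = q6 at *
  generalize poch (((n + 1 : ℕ) : ℂ) / 2 + γ + lam / 2) a = q7 at *
  generalize poch (-(β (n + 1) : ℂ)) a = q8 at *
  simp only [div_eq_mul_inv, mul_inv]
  rw [show ∀ x y z : ℂ, x * y * q6 * q7 * z = x * y * z * q6 * q7 from fun x y z => by ring]
  field_simp

theorem sum_contourCoeff_eq {γ ω lam : ℂ} {β : ℕ → ℕ} (hβ : Monotone β) (ht : -1 < lam.re)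
    (hu : 0 < (γ - 1 / 2 + lam / 2).re) (n : ℕ) (w : ℂ) :
    ∑ p ∈ Finset.range (β n + 1) ×ˢ Finset.range (β (n + 1) + 1),
        contourCoeff ω lam (n + 1) (β (n + 1)) (seriesCoeff γ ω lam β n) w p
        * (p.2.factorial / poch (γ + ((n + 1 : ℕ) : ℂ) / 2 - 1 + lam / 2 + p.1) (p.2 + 1))
        * (p.2.factorial / poch (((n + 1 : ℕ) : ℂ) / 2 + lam / 2 + p.1) (p.2 + 1))
      = seriesPoly γ ω lam β (n + 1) w := by
  set G : ℕ → ℕ → ℂ := fun a b => seriesCoeff γ ω lam β n a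
    * (transferFactor γ ω lam n a * pochRatio γ lam β (n + 1) a b) * w ^ b with hG
  -- With b = a + k the range overshoots `β (n + 1)`, where the ratio is zero.
  have hrow : ∀ a, ∑ k ∈ Finset.range (β (n + 1) + 1), G a (a + k)
      = ∑ b ∈ Finset.range (β (n + 1) + 1), if a ≤ b then G a b else 0 := by
    intro a
    rw [← Finset.sum_filter]
    have h := Finset.sum_Ico_eq_sum_range (G a) a (a + (β (n + 1) + 1))
    rw [Nat.add_sub_cancel_left] at h
    rw [← h]
    symm
    refine Finset.sum_subset (fun b hb => ?_) fun b hb hb' => ?_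
    · simp only [Finset.mem_filter, Finset.mem_range, Finset.mem_Ico] at hb ⊢
      omega
    · simp only [Finset.mem_filter, Finset.mem_range, Finset.mem_Ico] at hb hb'
      rw [hG]
      simp only
      rw [pochRatio_eq_zero a (by omega)]
      simp
  rw [Finset.sum_product]
  calc _ = ∑ a ∈ Finset.range (β n + 1), ∑ k ∈ Finset.range (β (n + 1) + 1), G a (a + k) :=
        Finset.sum_congr rfl fun a ha => Finset.sum_congr rfl fun k _ =>
          contourCoeff_mul_eq hβ ht hu n _ w (Nat.lt_succ_iff.1 (Finset.mem_range.1 ha))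
    _ = ∑ a ∈ Finset.range (β n + 1), ∑ b ∈ Finset.range (β (n + 1) + 1),
          if a ≤ b then G a b else 0 := Finset.sum_congr rfl fun a _ => hrow a
    _ = _ := ?_
  rw [Finset.sum_comm, seriesPoly]
  refine Finset.sum_congr rfl fun b _ => ?_
  rw [← Finset.sum_filter, seriesCoeff, Finset.sum_mul]
  refine Finset.sum_subset_zero_on_sdiff (fun a ha => ?_) (fun a ha => ?_) fun a _ => rfl
  · simp only [Finset.mem_filter, Finset.mem_range] at ha ⊢
    omega
  · simp only [Finset.mem_sdiff, Finset.mem_filter, Finset.mem_range] at ha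
    rw [seriesCoeff_eq_zero (by omega)]
    simp

/-! ### The nested integrals are polynomials. -/

section Nested

variable {γ ω lam : ℂ} {β : ℕ → ℕ} {r : ℕ → ℝ}

theorem re_pos_u (hu : 0 < (γ - 1 / 2 + lam / 2).re) (n : ℕ) :
    0 < (γ + ((n + 1 : ℕ) : ℂ) / 2 - 1 + lam / 2).re := by
  have : (0 : ℝ) ≤ n := Nat.cast_nonneg n
  simp at hu ⊢
  linarith

theorem re_pos_t (ht : -1 < lam.re) (n : ℕ) : 0 < (((n + 1 : ℕ) : ℂ) / 2 + lam / 2).re := by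
  have : (0 : ℝ) ≤ n := Nat.cast_nonneg n
  simp
  linarith

theorem nestedIntegral_eq (hβ : Monotone β) (ht : -1 < lam.re)
    (hu : 0 < (γ - 1 / 2 + lam / 2).re) (hr : ∀ j, 0 < r j ∧ r j < 1) (n : ℕ) :
    nestedIntegral γ ω lam β r n = seriesPoly γ ω lam β n := by
  induction n with
  | zero => rfl
  | succ n ih =>
    funext w
    rw [nestedIntegral, ih, ← sum_contourCoeff_eq hβ ht hu n w,
      ← integral_cpow_mul_sum (re_pos_t ht n)]
    exact congrArg (fun f : ℝ → ℂ => ∫ t in (0 : ℝ)..1, f t)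
      (tIntegrand_eq_sum (seriesCoeff γ ω lam β n) w (re_pos_u hu n) (hr (n + 1))
        (hβ (Nat.le_succ n)))

theorem differentiable_seriesPoly (n : ℕ) : Differentiable ℂ (seriesPoly γ ω lam β n) := by
  unfold seriesPoly
  fun_prop

theorem integrability_seriesPoly (hβ : Monotone β) (ht : -1 < lam.re)
    (hu : 0 < (γ - 1 / 2 + lam / 2).re) (hr : ∀ j, 0 < r j ∧ r j < 1) (n : ℕ) (w : ℂ) :
    IntervalIntegrable (tIntegrand γ ω lam β r (n + 1) (seriesPoly γ ω lam β n) w)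
        MeasureTheory.volume 0 1 ∧
      ∀ t : ℝ, IntervalIntegrable (uIntegrand γ ω lam β r (n + 1) (seriesPoly γ ω lam β n) w t)
          MeasureTheory.volume 0 1 ∧
        ∀ u : ℝ, CircleIntegrable (vIntegrand ω lam β (n + 1) (seriesPoly γ ω lam β n) w t u)
          0 (r (n + 1)) := by
  have hM := hβ (Nat.le_succ n)
  refine ⟨?_, fun t => ⟨?_, fun u => circleIntegrable_vIntegrand _ w (hr (n + 1)) hM t u⟩⟩
  · exact (tIntegrand_eq_sum (ω := ω) (seriesCoeff γ ω lam β n) w (re_pos_u hu n) (hr (n + 1))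
      hM).symm ▸ intervalIntegrable_cpow_mul_sum (re_pos_t ht n) _ _
  · exact (uIntegrand_eq_sum (γ := γ) (ω := ω) (seriesCoeff γ ω lam β n) w (hr (n + 1))
      hM t).symm ▸ intervalIntegrable_cpow_mul_sum (re_pos_u hu n) _ _

end Nested

/-! ### Absolute convergence and rearrangement. -/

section Convergence

variable {γ ω lam : ℂ} {β : ℕ → ℕ}

/-- The numerator is d₁ + (ω - 1)/2, and ‖d₁‖ ≥ 1/2 bounds its quotient by d₁; the decay comes from
‖d₂‖ ≥ n/2. -/
theorem norm_transferFactor_le (ht : -1 < lam.re) (hu : 0 < (γ - 1 / 2 + lam / 2).re) {n : ℕ}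
    (hn : 1 ≤ n) (a : ℕ) :
    ‖transferFactor γ ω lam n a‖ ≤ (2 + 2 * ‖ω - 1‖) / n := by
  have hn' : (1 : ℝ) ≤ n := by exact_mod_cast hn
  have ha : (0 : ℝ) ≤ a := Nat.cast_nonneg a
  set d₁ : ℂ := (a : ℂ) + 1 / 2 + lam / 2 + (n : ℂ) / 2 with hd₁
  set d₂ : ℂ := (a : ℂ) - 1 / 2 + γ + (n : ℂ) / 2 + lam / 2 with hd₂
  have h1 : (n : ℝ) / 2 ≤ ‖d₁‖ := by
    refine le_trans ?_ (Complex.re_le_norm _)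
    simp [hd₁]
    linarith
  have h2 : (n : ℝ) / 2 ≤ ‖d₂‖ := by
    refine le_trans ?_ (Complex.re_le_norm _)
    simp [hd₂] at hu ⊢
    linarith
  have h1' : d₁ ≠ 0 := norm_pos_iff.1 (by linarith)
  have hnum : (a : ℂ) + lam / 2 + ω / 2 + (n : ℂ) / 2 = d₁ + (ω - 1) / 2 := by
    rw [hd₁]; ring
  have h3 : ‖d₁ + (ω - 1) / 2‖ ≤ (1 + ‖ω - 1‖) * ‖d₁‖ := by
    refine (norm_add_le _ _).trans ?_
    rw [norm_div, Complex.norm_ofNat]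
    nlinarith [norm_nonneg (ω - 1)]
  rw [transferFactor, hnum, norm_div, norm_mul, ← div_div]
  calc ‖d₁ + (ω - 1) / 2‖ / ‖d₁‖ / ‖d₂‖ ≤ (1 + ‖ω - 1‖) / ((n : ℝ) / 2) := by
        refine div_le_div₀ (by positivity) ?_ (by linarith) h2
        rwa [div_le_iff₀ (by linarith)]
    _ = _ := by field_simp

theorem norm_pochStep_le (ht : -1 < lam.re) (hu : 0 < (γ - 1 / 2 + lam / 2).re) {n b : ℕ}
    (hn : 1 ≤ n) (hb : b ≤ β n) : ‖pochStep γ lam β n b‖ ≤ 4 * (β n / (n : ℝ) ^ 2) := by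
  have hn' : (1 : ℝ) ≤ n := by exact_mod_cast hn
  have hb0 : (0 : ℝ) ≤ b := Nat.cast_nonneg b
  have h1 : (n : ℝ) / 2 ≤ ‖1 + (n : ℂ) / 2 + lam / 2 + b‖ := by
    refine le_trans ?_ (Complex.re_le_norm _)
    simp
    linarith
  have h2 : (n : ℝ) / 2 ≤ ‖(n : ℂ) / 2 + γ + lam / 2 + b‖ := by
    refine le_trans ?_ (Complex.re_le_norm _)
    simp at hu ⊢
    linarith
  have h3 : ‖-(β n : ℂ) + b‖ ≤ β n := by
    rw [show -(β n : ℂ) + b = -((β n - b : ℕ) : ℂ) by rw [Nat.cast_sub hb]; ring, norm_neg,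
      Complex.norm_natCast]
    exact_mod_cast Nat.sub_le _ _
  rw [pochStep, norm_div, norm_mul]
  calc _ ≤ (β n : ℝ) / ((n : ℝ) / 2 * ((n : ℝ) / 2)) :=
        div_le_div₀ (by positivity) h3 (by positivity)
          (mul_le_mul h1 h2 (by positivity) (norm_nonneg _))
    _ = _ := by field_simp; norm_num

/-- The sum of the absolute values of the terms of `seriesPoly`. -/
noncomputable def absSeries (γ ω lam : ℂ) (β : ℕ → ℕ) (n : ℕ) (ρ : ℝ) : ℝ :=
  ∑ b ∈ Finset.range (β n + 1), ‖seriesCoeff γ ω lam β n b‖ * ρ ^ b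

theorem absSeries_nonneg (n : ℕ) {ρ : ℝ} (hρ : 0 ≤ ρ) : 0 ≤ absSeries γ ω lam β n ρ :=
  Finset.sum_nonneg fun _ _ => by positivity

/-- The bound is implicit: the last term is absorbed on the left once its factor is at most 1/2. -/
theorem absSeries_succ_le (hβ : Monotone β) (ht : -1 < lam.re)
    (hu : 0 < (γ - 1 / 2 + lam / 2).re) {n : ℕ} (hn : 1 ≤ n) {ρ : ℝ} (hρ : 0 ≤ ρ) :
    absSeries γ ω lam β (n + 1) ρ ≤ (2 + 2 * ‖ω - 1‖) / n * absSeries γ ω lam β n ρ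
      + 4 * (β (n + 1) / ((n + 1 : ℕ) : ℝ) ^ 2) * ρ * absSeries γ ω lam β (n + 1) ρ := by
  set e := seriesCoeff γ ω lam β with he
  set τ : ℝ := (2 + 2 * ‖ω - 1‖) / n
  set σ : ℝ := 4 * (β (n + 1) / ((n + 1 : ℕ) : ℝ) ^ 2) with hσ
  have hσ0 : 0 ≤ σ := by positivity
  have hext : absSeries γ ω lam β n ρ
      = ∑ b ∈ Finset.range (β (n + 1) + 1), ‖e n b‖ * ρ ^ b := by
    refine Finset.sum_subset (Finset.range_mono (Nat.succ_le_succ (hβ (Nat.le_succ n))))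
      fun b _ hb => ?_
    rw [seriesCoeff_eq_zero (by simp at hb; omega)]
    simp
  have h0 : ‖e (n + 1) 0‖ ≤ τ * ‖e n 0‖ := by
    rw [he, seriesCoeff_succ_zero ht hu, norm_mul]
    exact mul_le_mul_of_nonneg_right (norm_transferFactor_le ht hu hn 0) (norm_nonneg _)
  have h1 : ∀ b ∈ Finset.range (β (n + 1)), ‖e (n + 1) (b + 1)‖ * ρ ^ (b + 1)
      ≤ τ * (‖e n (b + 1)‖ * ρ ^ (b + 1)) + σ * ρ * (‖e (n + 1) b‖ * ρ ^ b) := by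
    intro b hb
    have : ‖e (n + 1) (b + 1)‖ ≤ τ * ‖e n (b + 1)‖ + σ * ‖e (n + 1) b‖ := by
      rw [he, seriesCoeff_succ_succ ht hu ω hβ]
      refine (norm_add_le _ _).trans ?_
      rw [norm_mul, norm_mul]
      exact add_le_add
        (mul_le_mul_of_nonneg_right (norm_transferFactor_le ht hu hn _) (norm_nonneg _))
        (mul_le_mul_of_nonneg_right
          (norm_pochStep_le ht hu (Nat.le_add_left 1 n) (Finset.mem_range.1 hb).le)
          (norm_nonneg _))
    calc _ ≤ (τ * ‖e n (b + 1)‖ + σ * ‖e (n + 1) b‖) * ρ ^ (b + 1) :=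
          mul_le_mul_of_nonneg_right this (by positivity)
      _ = _ := by ring
  have h2 : ∑ b ∈ Finset.range (β (n + 1)), ‖e (n + 1) b‖ * ρ ^ b
      ≤ absSeries γ ω lam β (n + 1) ρ := by
    rw [absSeries, Finset.sum_range_succ]
    exact le_add_of_nonneg_right (by positivity)
  calc absSeries γ ω lam β (n + 1) ρ
      = ∑ b ∈ Finset.range (β (n + 1)), ‖e (n + 1) (b + 1)‖ * ρ ^ (b + 1) + ‖e (n + 1) 0‖ := by
        rw [absSeries, Finset.sum_range_succ', pow_zero, mul_one]
    _ ≤ ∑ b ∈ Finset.range (β (n + 1)), (τ * (‖e n (b + 1)‖ * ρ ^ (b + 1))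
          + σ * ρ * (‖e (n + 1) b‖ * ρ ^ b)) + τ * ‖e n 0‖ :=
        add_le_add (Finset.sum_le_sum h1) h0
    _ = τ * absSeries γ ω lam β n ρ
          + σ * ρ * ∑ b ∈ Finset.range (β (n + 1)), ‖e (n + 1) b‖ * ρ ^ b := by
        rw [hext, Finset.sum_range_succ', Finset.sum_add_distrib, ← Finset.mul_sum,
          ← Finset.mul_sum]
        ring
    _ ≤ _ := by gcongr

theorem summable_absSeries (hβ : Monotone β) (ht : -1 < lam.re)
    (hu : 0 < (γ - 1 / 2 + lam / 2).re)
    (ho : (fun n : ℕ => (β n : ℝ)) =o[Filter.atTop] (fun n : ℕ => (n : ℝ) ^ 2))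
    {ρ κ : ℝ} (hρ : 0 ≤ ρ) (hκ : 0 ≤ κ) :
    Summable fun n => absSeries γ ω lam β n ρ * κ ^ n := by
  have hσ : Filter.Tendsto (fun n : ℕ => 4 * (β (n + 1) / ((n + 1 : ℕ) : ℝ) ^ 2) * ρ)
      Filter.atTop (nhds 0) := by
    have := ((ho.tendsto_div_nhds_zero.comp (Filter.tendsto_add_atTop_nat 1)).const_mul
      4).mul_const ρ
    simpa using this
  have hτ : Filter.Tendsto (fun n : ℕ => (2 + 2 * ‖ω - 1‖) / n * κ) Filter.atTop (nhds 0) := by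
    simpa using (tendsto_const_div_atTop_nhds_zero_nat (2 + 2 * ‖ω - 1‖)).mul_const κ
  -- Absorption with factor at most 1/2 costs a factor 2; a transfer bound times κ of at most 1/4
  -- then gives ratio 1/2.
  refine summable_of_ratio_norm_eventually_le (r := 1 / 2) (by norm_num) ?_
  filter_upwards [Filter.eventually_ge_atTop 1,
    hσ.eventually_le_const (show (0 : ℝ) < 1 / 2 by norm_num),
    hτ.eventually_le_const (show (0 : ℝ) < 1 / 4 by norm_num)] with n hn h1 h2
  have hS := absSeries_nonneg (γ := γ) (ω := ω) (lam := lam) (β := β) n hρ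
  have hS' := absSeries_nonneg (γ := γ) (ω := ω) (lam := lam) (β := β) (n + 1) hρ
  have h := absSeries_succ_le (ω := ω) hβ ht hu hn hρ
  rw [Real.norm_of_nonneg (by positivity), Real.norm_of_nonneg (by positivity)]
  have h3 : absSeries γ ω lam β (n + 1) ρ
      ≤ 2 * ((2 + 2 * ‖ω - 1‖) / n * absSeries γ ω lam β n ρ) := by
    have := mul_le_mul_of_nonneg_right h1 hS'
    linarith
  calc _ ≤ 2 * ((2 + 2 * ‖ω - 1‖) / n * absSeries γ ω lam β n ρ) * κ ^ (n + 1) :=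
        mul_le_mul_of_nonneg_right h3 (by positivity)
    _ = 2 * ((2 + 2 * ‖ω - 1‖) / n * κ) * (absSeries γ ω lam β n ρ * κ ^ n) := by ring
    _ ≤ 1 / 2 * (absSeries γ ω lam β n ρ * κ ^ n) :=
        mul_le_mul_of_nonneg_right (by linarith) (by positivity)

theorem summable_gchCoeff {μ ε ν c₀ : ℂ} {Ω : ℕ → ℂ} (hγ : γ = 1 / 2 * (1 + ν))
    (hβ : Monotone β) (ht : -1 < lam.re) (hu : 0 < (γ - 1 / 2 + lam / 2).re)
    (hΩ : ∀ i : ℕ, Ω i = -μ * (2 * (β i : ℂ) + (i : ℂ) + lam))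
    (ho : (fun n : ℕ => (β n : ℝ)) =o[Filter.atTop] (fun n : ℕ => (n : ℝ) ^ 2)) (x : ℂ) :
    Summable fun p : ℕ × ℕ => gchCoeff μ ε ν ω lam c₀ Ω p.1 p.2 * x ^ p.1 := by
  have hinj : Function.Injective fun p : ℕ × ℕ => (p.1 + 2 * p.2, p.1) := by
    rintro ⟨a, b⟩ ⟨c, d⟩ h
    simp only [Prod.mk.injEq] at h ⊢
    omega
  rw [← hinj.summable_iff]
  · refine Summable.of_norm ?_
    have hrow : ∀ n, HasSum (fun i => ‖gchCoeff μ ε ν ω lam c₀ Ω (n + 2 * i) n * x ^ (n + 2 * i)‖)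
        (‖c₀‖ * (absSeries γ ω lam β n ‖-(1 / 2) * μ * x ^ 2‖ * ‖-(1 / 2) * ε * x‖ ^ n)) := by
      intro n
      have hterm : ∀ i, ‖gchCoeff μ ε ν ω lam c₀ Ω (n + 2 * i) n * x ^ (n + 2 * i)‖
          = ‖c₀‖ * (‖seriesCoeff γ ω lam β n i‖ * ‖-(1 / 2) * μ * x ^ 2‖ ^ i
            * ‖-(1 / 2) * ε * x‖ ^ n) := by
        intro i
        rw [gchCoeff_even hγ ht hu hβ hΩ, ← norm_pow, ← norm_pow, ← norm_mul, ← norm_mul,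
          ← norm_mul]
        congr 1
        rw [mul_pow _ (x ^ 2), mul_pow _ x, ← pow_mul, pow_add]
        ring
      simp only [hterm]
      rw [absSeries, Finset.sum_mul, Finset.mul_sum]
      refine hasSum_sum_of_ne_finset_zero fun i hi => ?_
      rw [seriesCoeff_eq_zero (by simp at hi; omega)]
      simp
    rw [summable_prod_of_nonneg fun _ => norm_nonneg _]
    refine ⟨fun n => (hrow n).summable, ?_⟩
    refine ((summable_absSeries (ω := ω) hβ ht hu ho
      (norm_nonneg (-(1 / 2) * μ * x ^ 2)) (norm_nonneg (-(1 / 2) * ε * x))).mul_left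
        ‖c₀‖).congr fun n => ?_
    exact (hrow n).tsum_eq.symm
  · rintro ⟨m, n⟩ hmn
    simp only
    rcases lt_or_ge m n with h | h
    · rw [gchCoeff_eq_zero_of_lt h, zero_mul]
    · obtain ⟨i, hi | hi⟩ : ∃ i, m = n + 2 * i ∨ m = n + 2 * i + 1 := ⟨(m - n) / 2, by omega⟩
      · exact absurd ⟨(n, i), by rw [hi]⟩ hmn
      · rw [hi, gchCoeff_odd, zero_mul]

/-- Fubini for the double series: rows give the Frobenius coefficients, columns the sub-power
series. -/
theorem hasSum_gchSub {μ ε ν c₀ : ℂ} {Ω : ℕ → ℂ} {x : ℂ}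
    (h : Summable fun p : ℕ × ℕ => gchCoeff μ ε ν ω lam c₀ Ω p.1 p.2 * x ^ p.1) :
    HasSum (fun n => gchSub μ ε ν ω lam c₀ Ω n x) (gchPolynomial μ ε ν ω lam c₀ Ω x) := by
  have hrow : ∀ m, HasSum (fun n => gchCoeff μ ε ν ω lam c₀ Ω m n * x ^ m)
      ((∑ n ∈ Finset.range (m + 1), gchCoeff μ ε ν ω lam c₀ Ω m n) * x ^ m) := by
    intro m
    rw [Finset.sum_mul]
    refine hasSum_sum_of_ne_finset_zero fun n hn => ?_
    rw [gchCoeff_eq_zero_of_lt (by simp at hn; omega), zero_mul]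
  have h1 := (h.hasSum.prod_fiberwise hrow).tsum_eq
  have h2 := (Equiv.prodComm ℕ ℕ).hasSum_iff.2 h.hasSum
  have h3 := h2.prod_fiberwise fun n => (h2.summable.prod_factor n).hasSum
  rw [gchPolynomial, h1]
  exact h3.mul_left _

end Convergence
-- Assembly.
theorem theorem1 (μ ε ν ω lam c₀ : ℂ) (β : ℕ → ℕ) (Ω : ℕ → ℂ) (r : ℕ → ℝ)
    (γ x z εt : ℂ)
    -- `lam` is an indicial exponent
    (hlam : lam = 0 ∨ lam = 1 - ν)
    -- the integrals in `t` and `u` converge at `0`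
    (ht : -1 < lam.re) (hu : 0 < (ν + lam).re)
    (hβ : Monotone β)
    (hΩ : ∀ i : ℕ, Ω i = -μ * (2 * (β i : ℂ) + (i : ℂ) + lam))
    (hr : ∀ j, 0 < r j ∧ r j < 1)
    (hγ : γ = 1 / 2 * (1 + ν)) (hz : z = -(1 / 2) * μ * x ^ 2) (hεt : εt = -(1 / 2) * ε * x) :
    -- the `B`-terms terminate: every sub-power series is a finite sum
    (∀ n m, n + 2 * β n < m → gchCoeff μ ε ν ω lam c₀ Ω m n = 0) ∧
    -- all functions that are differentiated and integrated are differentiable and integrable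
    (∀ n, Differentiable ℂ (nestedIntegral γ ω lam β r n) ∧
      ∀ w : ℂ,
        IntervalIntegrable
          (tIntegrand γ ω lam β r (n + 1) (nestedIntegral γ ω lam β r n) w)
          MeasureTheory.volume 0 1 ∧
        ∀ t ∈ Set.Icc (0 : ℝ) 1,
          IntervalIntegrable
            (uIntegrand γ ω lam β r (n + 1) (nestedIntegral γ ω lam β r n) w t)
            MeasureTheory.volume 0 1 ∧
          ∀ u ∈ Set.Icc (0 : ℝ) 1,
            CircleIntegrable
              (vIntegrand ω lam β (n + 1) (nestedIntegral γ ω lam β r n) w t u) 0 (r (n + 1))) ∧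
    -- every sub-power series: closed form and integral representation
    (∀ n, gchSub μ ε ν ω lam c₀ Ω n x = c₀ * x ^ lam * (gchClosedSum γ ω lam β n z * εt ^ n) ∧
      gchSub μ ε ν ω lam c₀ Ω n x
        = c₀ * x ^ lam * (nestedIntegral γ ω lam β r n z * εt ^ n)) ∧
    -- the integral representation of the whole series, wherever it converges absolutely
    (Summable (fun p : ℕ × ℕ => gchCoeff μ ε ν ω lam c₀ Ω p.1 p.2 * x ^ p.1) →
      HasSum (fun n => gchSub μ ε ν ω lam c₀ Ω n x) (gchPolynomial μ ε ν ω lam c₀ Ω x) ∧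
      Summable (fun n : ℕ =>
        c₀ * x ^ lam * (nestedIntegral γ ω lam β r (n + 1) z * εt ^ (n + 1))) ∧
      gchPolynomial μ ε ν ω lam c₀ Ω x
        = c₀ * x ^ lam *
          (baseSum γ lam β z
            + ∑' n : ℕ, nestedIntegral γ ω lam β r (n + 1) z * εt ^ (n + 1))) ∧
    -- absolute convergence holds for all `x` as soon as `β n = o(n²)`
    ((fun n : ℕ => (β n : ℝ)) =o[Filter.atTop] (fun n : ℕ => (n : ℝ) ^ 2) →
      Summable (fun p : ℕ × ℕ => gchCoeff μ ε ν ω lam c₀ Ω p.1 p.2 * x ^ p.1)) := by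
  have hu' : 0 < (γ - 1 / 2 + lam / 2).re := by
    have : (γ - 1 / 2 + lam / 2).re = (ν + lam).re / 2 := by
      rw [show γ - 1 / 2 + lam / 2 = (ν + lam) / 2 by rw [hγ]; ring]
      simp
    rw [this]
    exact half_pos hu
  have hnested := nestedIntegral_eq (ω := ω) hβ ht hu' hr
  have hsub : ∀ n, gchSub μ ε ν ω lam c₀ Ω n x
      = c₀ * x ^ lam * (nestedIntegral γ ω lam β r n z * εt ^ n) := fun n => by
    rw [gchSub_eq hγ ht hu' hβ hΩ, hnested, hz, hεt]
  refine ⟨fun n m h => gchCoeff_eq_zero_of_gt hγ ht hu' hβ hΩ h, fun n => ?_, fun n => ?_,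
    fun h => ?_, fun ho => summable_gchCoeff hγ hβ ht hu' hΩ ho x⟩
  · rw [hnested]
    refine ⟨differentiable_seriesPoly n, fun w => ?_⟩
    obtain ⟨h1, h2⟩ := integrability_seriesPoly (ω := ω) hβ ht hu' hr n w
    exact ⟨h1, fun t _ => ⟨(h2 t).1, fun u _ => (h2 t).2 u⟩⟩
  · refine ⟨?_, hsub n⟩
    rw [hsub, gchClosedSum_eq, hnested]
  · have hs := hasSum_gchSub h
    have hs' := hs.summable
    have ht' := hs.tsum_eq
    simp only [hsub] at hs' ht'
    refine ⟨hs, (summable_nat_add_iff 1).2 hs', ?_⟩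
    -- Over a field `tsum_mul_left` needs no summability, so `c₀ * x ^ lam = 0` is covered too.
    rw [← ht', hs'.tsum_eq_zero_add, tsum_mul_left, mul_add, pow_zero, mul_one]
    rfl
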